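/- Let $k$ be a field of characteristic zero, let $A$ be a commutative $k$-algebra, let $I$ be a free $A$-module of finite rank, and let $0\to I\to B\xrightarrow{\pi} A\to 0$ be a trivial square-zero extension of $A$ by $I$, i.e. $B$ is a commutative $k$-algebra, $\pi$ is a surjective morphism of $k$-algebras with kernel $I$, $I^2=0$, the $A$-module structure of $I$ is induced by the multiplication of $B$, and $\pi$ has a section that is a morphism of $k$-algebras. Complexes are graded homologically. For a complex $K_\bullet$ of $B$-modules that vanishes in all sufficiently negative homological degrees, let $K_\bullet\otimes^{\mathbb L}_B A$ be the derived pullback, i.e. the complex of $A$-modules $P_\bullet\otimes_B A$, where $P_\bullet\to K_\bullet$ is a quasi-isomorphism and $P_\bullet$ is a complex of projective $B$-modules that vanishes in all sufficiently negative degrees; put $\mathbf{Tor}^i_B(K_\bullet,A)=\mathrm H_i(K_\bullet\otimes^{\mathbb L}_B A)$, and let $\mathrm{Tor}^1_B(K_\bullet,A)$ be the complex of $A$-modules obtained by applying $\mathrm{Tor}^1_B(-,A)$ to each term of $K_\bullet$. The complex $K_\bullet$ is called admissible if $\mathrm H_i(\mathrm{Tor}^1_B(K_\bullet,A))=0$ for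 all $i\in\mathbb Z$. If $K_\bullet$ is concentrated in nonnegative homological degrees and $n\in\mathbb N\cup\{+\infty\}$, it is called $n$-admissible if $\mathrm H_i(\mathrm{Tor}^1_B(K_\bullet,A))=0$ for all $0\le i\le n-1$; thus admissible means $\infty$-admissible for such complexes. A complex of modules over a commutative ring is called perfect if it is isomorphic in the derived category to a bounded complex of finitely generated projective modules. Then the following hold. (1) Let $K_\bullet$ be a complex of $B$-modules concentrated in nonnegative homological degrees and let $n\in\mathbb N\cup\{+\infty\}$. Then $K_\bullet$ is $n$-admissible if and only if the natural map $\mathbf{Tor}^i_B(K_\bullet,A)\to \mathrm H_i(K_\bullet\otimes_B A)$ is an isomorphism for all $0\le i\le n$ and is surjective for $i=n+1$ (the last condition being empty if $n=+\infty$). (2) Let $m$ be an integer and let $K_\bullet$ be a complex of $B$-modules concentrated in homological degrees $\ge -m$. Then $K_\bullet$ is isomorphic in the derived category of $B$-modules to a bounded admissible complex concentrated in homological degrees $\ge -m$ if and only if $K_\bullet\otimes^{\mathbb L}_B A$ is cohomologically bounded, i.e. has nonzero homology only in a bounded range of degrees. (3) Let $K_\bullet$ be a bounded complex of $B$-modules.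 Then $K_\bullet$ is perfect if and only if $K_\bullet\otimes^{\mathbb L}_B A$ is perfect. -/

import Mathlib

open CategoryTheory Opposite

universe w u v

noncomputable section

/-! Complexes are `ℤ`-graded cochain complexes; the homological degree `i` is the cochain
degree `-i`. A complex concentrated in nonnegative homological degrees is one that satisfies
`K.IsStrictlyLE 0`. -/

/-- A trivial extension `0 → I → B → A → 0` of the commutative `k`-algebra `A` by the `A`-module
`I`: the ideal `I` of `B` has square zero, its `A`-module structure is the one induced by the
multiplication of `B`, and `B → A` has a section that is a morphism of `k`-algebras. -/
structure TrivialExtension (k : Type v) (A B : Type u) (I : Type w) [Field k]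
    [CommRing A] [Algebra k A] [CommRing B] [Algebra k B] [AddCommGroup I] [Module A I] where
  /-- the inclusion of the ideal -/
  ι : I →+ B
  /-- the projection -/
  π : B →ₐ[k] A
  ι_injective : Function.Injective ι
  π_surjective : Function.Surjective π
  exact : Function.Exact ι π
  sq_zero : ∀ i j : I, ι i * ι j = 0
  smul_eq : ∀ (b : B) (i : I), ι (π b • i) = b * ι i
  split : ∃ σ : A →ₐ[k] B, π.comp σ = AlgHom.id k A

namespace DerivedPullback

section Resolutions

variable {C : Type u} [Category.{v} C] [Abelian C]

theorem quasiIso_neg {K L : CochainComplex C ℤ} (f : K ⟶ L) [QuasiIso f] :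
    QuasiIso ((ChainComplex.cochainComplexEquivalence C).inverse.map f) where
  quasiIsoAt n := by
    rw [quasiIsoAt_iff' _ (n + 1) n (n - 1) (by simp) (by simp)]
    exact (quasiIsoAt_iff' f (-(n + 1)) (-n) (-(n - 1)) (by simp; lia)
      (by simp; lia)).1 inferInstance

theorem exists_projective_quasiIso [EnoughProjectives C] (K : CochainComplex C ℤ) (m : ℤ)
    [K.IsStrictlyLE m] :
    ∃ (P : CochainComplex C ℤ) (f : P ⟶ K), P.IsStrictlyLE m ∧
      (∀ i, Projective (P.X i)) ∧ QuasiIso f := by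
  let e := CochainComplex.opEquivalence C
  have : (e.functor.obj (op K)).IsStrictlyGE (-m) := by
    rw [CochainComplex.isStrictlyGE_iff]
    intro i hi
    exact (K.isZero_of_isStrictlyLE m (-i) (by lia)).op
  obtain ⟨J, i, _, hJ, _⟩ :=
    CochainComplex.Plus.modelCategoryQuillen.exists_quasiIso_injective
      (e.functor.obj (op K)) (-m)
  refine ⟨(e.inverse.obj J).unop,
    (e.inverse.map i).unop ≫ (e.unitIso.hom.app (op K)).unop, ?_, ?_, ?_⟩
  · rw [CochainComplex.isStrictlyLE_iff]
    intro i hi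
    exact (J.isZero_of_isStrictlyGE (-m) (-i) (by lia)).unop
  · intro i
    have := hJ (-i)
    exact inferInstanceAs (Projective (J.X (-i)).unop)
  · have h1 := quasiIso_neg i
    have : QuasiIso (e.inverse.map i).unop :=
      (HomologicalComplex.quasiIso_unopFunctor_map_iff (c := ComplexShape.down ℤ)
        ((ChainComplex.cochainComplexEquivalence _).inverse.map i)).2 h1
    have : IsIso (e.unitIso.hom.app (op K)).unop := inferInstance
    infer_instance

/-- `K` is bounded above as a cochain complex, i.e. an object of `C⁻`. -/
def IsBoundedAbove (K : CochainComplex C ℤ) : Prop := ∃ m : ℤ, K.IsStrictlyLE m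

/-- `K` is bounded below as a cochain complex. -/
def IsBoundedBelow (K : CochainComplex C ℤ) : Prop := ∃ m : ℤ, K.IsStrictlyGE m

/-- The cohomology of `K` vanishes outside a bounded range of degrees. -/
def IsCohomologicallyBounded (K : CochainComplex C ℤ) : Prop :=
  ∃ a b : ℤ, ∀ i : ℤ, i < a ∨ b < i → Limits.IsZero (K.homology i)

attribute [local instance] HasDerivedCategory.standard in
/-- `K` and `L` are isomorphic in the derived category. -/
def DerivedIso (K L : CochainComplex C ℤ) : Prop :=
  Nonempty (DerivedCategory.Q.obj K ≅ DerivedCategory.Q.obj L)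

/-- A projective resolution of a complex: a quasi-isomorphism from a bounded above complex of
projective objects. -/
structure ProjRes (K : CochainComplex C ℤ) where
  /-- the resolving complex -/
  P : CochainComplex C ℤ
  /-- the augmentation -/
  f : P ⟶ K
  boundedAbove : IsBoundedAbove P
  projective : ∀ i, Projective (P.X i)
  quasiIso : QuasiIso f

theorem nonempty_projRes [EnoughProjectives C] {K : CochainComplex C ℤ} (hK : IsBoundedAbove K) :
    Nonempty (ProjRes K) := by
  obtain ⟨m, hm⟩ := hK
  obtain ⟨P, f, h1, h2, h3⟩ := exists_projective_quasiIso K m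
  exact ⟨⟨P, f, ⟨m, h1⟩, h2, h3⟩⟩

/-- A chosen projective resolution of a bounded above complex; it is unique up to homotopy
equivalence. -/
def projRes [EnoughProjectives C] (K : CochainComplex C ℤ) (hK : IsBoundedAbove K) : ProjRes K :=
  (nonempty_projRes hK).some

end Resolutions

/-- A complex of `R`-modules is perfect if it is isomorphic in the derived category to a bounded
complex of finitely generated projective modules. -/
def IsPerfect {R : Type u} [CommRing R] (K : CochainComplex (ModuleCat.{u} R) ℤ) : Prop :=
  ∃ P : CochainComplex (ModuleCat.{u} R) ℤ, IsBoundedAbove P ∧ IsBoundedBelow P ∧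
    (∀ i, Module.Finite R (P.X i) ∧ Module.Projective R (P.X i)) ∧ DerivedIso K P

variable {A B : Type u} [CommRing A] [CommRing B] (π : B →+* A)

/-- The functor `V ↦ V ⊗_B A` from `B`-modules to `A`-modules. -/
def baseChange : ModuleCat.{u} B ⥤ ModuleCat.{u} A := ModuleCat.extendScalars.{u, u, u} π

instance : (baseChange π).Additive :=
  (ModuleCat.extendRestrictScalarsAdj.{u} π).left_adjoint_additive

/-- The functor `V ↦ Tor^p_B(V, A)` from `B`-modules to `A`-modules. -/
def tor (p : ℕ) : ModuleCat.{u} B ⥤ ModuleCat.{u} A := (baseChange π).leftDerived p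

instance (p : ℕ) : (tor π p).PreservesZeroMorphisms where
  map_zero X Y := by
    have h := Functor.leftDerived_map_eq (baseChange π) p (0 : X ⟶ Y)
      (P := projectiveResolution X) (Q := projectiveResolution Y) 0 (by simp)
    refine h.trans ?_
    rw [Functor.map_zero, Limits.zero_comp, Limits.comp_zero]
    rfl

/-- The functor `K ↦ K ⊗_B A` on complexes. -/
def pullback : CochainComplex (ModuleCat.{u} B) ℤ ⥤ CochainComplex (ModuleCat.{u} A) ℤ :=
  (baseChange π).mapHomologicalComplex (ComplexShape.up ℤ)

/-- The complex `Tor^1_B(K, A)`, obtained by applying `Tor^1_B(-, A)` to each term of `K`. -/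
def torOne (K : CochainComplex (ModuleCat.{u} B) ℤ) : CochainComplex (ModuleCat.{u} A) ℤ :=
  ((tor π 1).mapHomologicalComplex (ComplexShape.up ℤ)).obj K

/-- For `K` concentrated in nonnegative homological degrees: `K` is `n`-admissible if
`H_i(Tor^1_B(K, A)) = 0` for `0 ≤ i ≤ n - 1`. -/
def IsNAdmissible (n : ℕ∞) (K : CochainComplex (ModuleCat.{u} B) ℤ) : Prop :=
  ∀ i : ℕ, (i : ℕ∞) < n → Limits.IsZero ((torOne π K).homology (-(i : ℤ)))

/-- `K` is admissible if `Tor^1_B(K, A)` is acyclic. -/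
def IsAdmissible (K : CochainComplex (ModuleCat.{u} B) ℤ) : Prop :=
  ∀ i : ℤ, Limits.IsZero ((torOne π K).homology i)

/-- In nonnegative homological degrees, admissible means `∞`-admissible. -/
theorem isAdmissible_iff (K : CochainComplex (ModuleCat.{u} B) ℤ) [K.IsStrictlyLE 0] :
    IsAdmissible π K ↔ IsNAdmissible π ⊤ K := by
  refine ⟨fun h i _ => h _, fun h i => ?_⟩
  obtain hi | hi := le_or_gt i 0
  · obtain ⟨j, rfl⟩ : ∃ j : ℕ, i = -(j : ℤ) := ⟨i.natAbs, by lia⟩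
    exact h j (ENat.natCast_lt_top j)
  · refine HomologicalComplex.ExactAt.isZero_homology ?_
    exact HomologicalComplex.ExactAt.of_isZero
      ((tor π 1).map_isZero (K.isZero_of_isStrictlyLE 0 i hi))

/-- The derived pullback `K ⊗^L_B A` of a bounded above complex `K`, computed by a projective
resolution of `K`. -/
def derivedPullback (K : CochainComplex (ModuleCat.{u} B) ℤ) (hK : IsBoundedAbove K) :
    CochainComplex (ModuleCat.{u} A) ℤ :=
  (pullback π).obj (projRes K hK).P

/-- The natural morphism `K ⊗^L_B A ⟶ K ⊗_B A`. -/
def derivedPullbackTo (K : CochainComplex (ModuleCat.{u} B) ℤ) (hK : IsBoundedAbove K) :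
    derivedPullback π K hK ⟶ (pullback π).obj K :=
  (pullback π).map (projRes K hK).f

/-- The hypertor module `𝐓𝐨𝐫^i_B(K, A) = H_i(K ⊗^L_B A)`. -/
def hypertor (K : CochainComplex (ModuleCat.{u} B) ℤ) (hK : IsBoundedAbove K) (i : ℤ) :
    ModuleCat.{u} A :=
  (derivedPullback π K hK).homology (-i)

/-- The natural map from `𝐓𝐨𝐫^i_B(K, A)` to `H_i(K ⊗_B A)`. -/
def hypertorTo (K : CochainComplex (ModuleCat.{u} B) ℤ) (hK : IsBoundedAbove K) (i : ℤ) :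
    hypertor π K hK i ⟶ ((pullback π).obj K).homology (-i) :=
  HomologicalComplex.homologyMap (derivedPullbackTo π K hK) (-i)

end DerivedPullback

end

/-! Write `F = - ⊗_B A`, `S = I ⊗_A -`, and `G` for restriction of scalars along the section.
Multiplication by `I` gives natural maps `S F V ⟶ G V ⟶ F V ⟶ 0`, exact for every `V` (`exact_α_β`)
and short exact for `V` projective. Applied to a projective resolution, this shows that the kernel
of `S F V ⟶ G V` is `Tor^1_B(V, A)`. As `G` is exact and faithful and `S` is exact, the three
statements follow formally.

For (1), let `C` be the cone of a projective resolution `P ⟶ K`. Then `G C` is acyclic, and the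
four-term sequence moves the homology of `F C` two degrees up to that of `Tor^1(C)`, wherever `F C`
is already exact in the next two degrees. Descending induction from the upper bound compares the
exactness of `F C` with that of `Tor^1(C)`, which is `Tor^1(K)` termwise because `P` is projective
(`forall_exactAt_mappingCone_map_iff`).

For (2), an admissible `L` has `F P` quasi-isomorphic to `F L`, which is bounded if `L` is.
Conversely, truncate a projective resolution `P` below the homology of `F P`: `P` is exact there,
and the one new term, a module of opcycles, has vanishing `Tor^1` (`mono_app_opcycles`).

For (3), two composable maps killed by `F` compose to zero. A bounded complex `Q` of finite
projective `A`-modules that is homotopy equivalent to `F P` is pulled back along the section; its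
differential is then perturbed so that the homotopy equivalence lifts to a morphism to `P`
(`exists_lift_of_homotopyEquiv`). The lift is a quasi-isomorphism because `F` detects exactness on
complexes of projectives. -/

noncomputable section

namespace DerivedPullback

open Limits HomologicalComplex

/-! ### Cones, derived isomorphisms and four-term exact sequences of complexes -/

section Homology

variable {C : Type u} [Category.{v} C] [Abelian C]

attribute [local instance] HasDerivedCategory.standard in
-- Read off from the long exact sequence of the cone. It is used degree by degree, since
-- `n`-admissibility controls only finitely many degrees when `n` is finite.
theorem exactAt_mappingCone_iff {K L : CochainComplex C ℤ} (φ : K ⟶ L) (n m : ℤ)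
    (h : n + 1 = m) :
    (CochainComplex.mappingCone φ).ExactAt n ↔
      Epi (homologyMap φ n) ∧ Mono (homologyMap φ m) := by
  have hT := DerivedCategory.mappingCone_triangle_distinguished φ
  have h₁ := CochainComplex.homologyMap_exact₁_of_distTriang _ hT n m h
  have h₂ := CochainComplex.homologyMap_exact₂_of_distTriang _ hT n
  have h₃ := CochainComplex.homologyMap_exact₃_of_distTriang _ hT n m h
  rw [exactAt_iff_isZero_homology]
  constructor
  · intro hz
    exact ⟨h₂.epi_f (hz.eq_of_tgt _ _), h₁.mono_g (hz.eq_of_src _ _)⟩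
  · rintro ⟨h4, h5⟩
    have h4' : Epi (homologyMap (CochainComplex.mappingCone.triangle φ).mor₁ n) := h4
    have h5' : Mono (homologyMap (CochainComplex.mappingCone.triangle φ).mor₁ m) := h5
    refine h₃.isZero_of_both_zeros ?_ ?_
    · rw [← cancel_epi (homologyMap (CochainComplex.mappingCone.triangle φ).mor₁ n)]
      exact (CochainComplex.homologyMap_comp_eq_zero_of_distTriang _ hT n).trans comp_zero.symm
    · rw [← cancel_mono (homologyMap (CochainComplex.mappingCone.triangle φ).mor₁ m)]
      exact (CochainComplex.homologyδOfTriangle_homologyMap _ hT n m h).trans zero_comp.symm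

theorem acyclic_mappingCone_iff {K L : CochainComplex C ℤ} (φ : K ⟶ L) :
    (CochainComplex.mappingCone φ).Acyclic ↔ QuasiIso φ := by
  constructor
  · intro h
    refine ⟨fun n => ?_⟩
    have h₁ := (exactAt_mappingCone_iff φ n (n + 1) rfl).1 (h n)
    have h₂ := (exactAt_mappingCone_iff φ (n - 1) n (by lia)).1 (h (n - 1))
    have := h₁.1
    have := h₂.2
    rw [quasiIsoAt_iff_isIso_homologyMap]
    exact isIso_of_mono_of_epi _
  · intro h n
    rw [exactAt_mappingCone_iff φ n (n + 1) rfl]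
    constructor <;> infer_instance

attribute [local instance] HasDerivedCategory.standard in
theorem DerivedIso.of_quasiIso {K L : CochainComplex C ℤ} (φ : K ⟶ L) [QuasiIso φ] :
    DerivedIso K L :=
  ⟨asIso (DerivedCategory.Q.map φ)⟩

theorem DerivedIso.symm {K L : CochainComplex C ℤ} (h : DerivedIso K L) : DerivedIso L K :=
  ⟨h.some.symm⟩

theorem DerivedIso.trans {K L M : CochainComplex C ℤ} (h : DerivedIso K L)
    (h' : DerivedIso L M) : DerivedIso K M :=
  ⟨h.some ≪≫ h'.some⟩

theorem DerivedIso.of_homotopyEquiv {K L : CochainComplex C ℤ} (e : HomotopyEquiv K L) :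
    DerivedIso K L :=
  have := e.quasiIso_hom
  .of_quasiIso e.hom

attribute [local instance] HasDerivedCategory.standard in
/-- A morphism in the derived category between complexes that are K-projective comes from a
homotopy equivalence if it is an isomorphism. -/
theorem DerivedIso.nonempty_homotopyEquiv {K L : CochainComplex C ℤ} [K.IsKProjective]
    [L.IsKProjective] (h : DerivedIso K L) : Nonempty (HomotopyEquiv K L) := by
  obtain ⟨e⟩ := h
  -- Out of a K-projective complex, derived maps are homotopy classes of maps: lift both directions,
  -- then check the two compositions by injectivity.
  obtain ⟨g, hg⟩ := (CochainComplex.IsKProjective.Qh_map_bijective K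
    ((HomotopyCategory.quotient _ _).obj L)).surjective
    ((DerivedCategory.quotientCompQhIso C).hom.app K ≫ e.hom ≫
      (DerivedCategory.quotientCompQhIso C).inv.app L)
  obtain ⟨g', hg'⟩ := (CochainComplex.IsKProjective.Qh_map_bijective L
    ((HomotopyCategory.quotient _ _).obj K)).surjective
    ((DerivedCategory.quotientCompQhIso C).hom.app L ≫ e.inv ≫
      (DerivedCategory.quotientCompQhIso C).inv.app K)
  refine ⟨HomotopyCategory.homotopyEquivOfIso ⟨g, g', ?_, ?_⟩⟩
  · apply (CochainComplex.IsKProjective.Qh_map_bijective K _).injective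
    simp [hg, hg']
  · apply (CochainComplex.IsKProjective.Qh_map_bijective L _).injective
    simp [hg, hg']

theorem isKProjective {P : CochainComplex C ℤ} (hP : IsBoundedAbove P)
    (h : ∀ i, Projective (P.X i)) : P.IsKProjective := by
  obtain ⟨m, hm⟩ := hP
  exact CochainComplex.isKProjective_of_projective P m

/-- Let `0 → T → G → D → F → 0` be an exact sequence of complexes with `D` acyclic. If `G` is
exact in the degrees `j` and `j + 1`, then `F` is exact in degree `j - 1` if and only if `T` is
exact in degree `j + 1`. -/
theorem exactAt_iff_of_exact {T G D F : CochainComplex C ℤ} (θ : T ⟶ G) (α : G ⟶ D) (β : D ⟶ F)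
    (w₁ : θ ≫ α = 0) (w₂ : α ≫ β = 0) [Mono θ] (h₁ : (ShortComplex.mk θ α w₁).Exact)
    (h₂ : (ShortComplex.mk α β w₂).Exact) [Epi β] (hD : D.Acyclic) (j₀ j₁ j₂ : ℤ)
    (h₀₁ : j₀ + 1 = j₁) (h₁₂ : j₁ + 1 = j₂) (hG₁ : G.ExactAt j₁) (hG₂ : G.ExactAt j₂) :
    F.ExactAt j₀ ↔ T.ExactAt j₂ := by
  -- Split the sequence at `kernel β`; the two connecting maps are isomorphisms, each raising the
  -- degree by one.
  have hS₂ : (ShortComplex.mk (kernel.ι β) β (kernel.condition β)).ShortExact :=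
    { exact := ShortComplex.exact_kernel β }
  have he : Epi (kernel.lift β α w₂) := (ShortComplex.exact_iff_epi_kernel_lift _).1 h₂
  have h₀ : θ ≫ kernel.lift β α w₂ = 0 := by
    rw [← cancel_mono (kernel.ι β)]
    simp [w₁]
  have hS₁ : (ShortComplex.mk θ (kernel.lift β α w₂) h₀).ShortExact :=
    { exact := by
        let φ : ShortComplex.mk θ (kernel.lift β α w₂) h₀ ⟶ ShortComplex.mk θ α w₁ :=
          { τ₁ := 𝟙 _, τ₂ := 𝟙 _, τ₃ := kernel.ι β }
        have : Epi φ.τ₁ := inferInstanceAs (Epi (𝟙 T))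
        have : IsIso φ.τ₂ := inferInstanceAs (IsIso (𝟙 G))
        have : Mono φ.τ₃ := inferInstanceAs (Mono (kernel.ι β))
        exact (ShortComplex.exact_iff_of_epi_of_isIso_of_mono φ).2 h₁ }
  have e₁ := hS₂.δIso j₀ j₁ h₀₁ (hD j₀).isZero_homology (hD j₁).isZero_homology
  have e₂ := hS₁.δIso j₁ j₂ h₁₂ hG₁.isZero_homology hG₂.isZero_homology
  rw [exactAt_iff_isZero_homology, exactAt_iff_isZero_homology, e₁.isZero_iff, e₂.isZero_iff]

end Homology

/-! ### Exactness under exact functors -/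

section MapExact

variable {C D : Type*} [Category* C] [Category* D] [Abelian C] [Abelian D] {ι : Type*}
  {c : ComplexShape ι}

theorem exactAt_iff_of_iso {K L : HomologicalComplex C c} (e : K ≅ L) (i : ι) :
    K.ExactAt i ↔ L.ExactAt i :=
  ⟨fun h => h.of_iso e, fun h => h.of_iso e.symm⟩

theorem exactAt_map {K : HomologicalComplex C c} {i : ι} (h : K.ExactAt i) (F : C ⥤ D)
    [F.Additive] [PreservesFiniteLimits F] [PreservesFiniteColimits F] :
    ((F.mapHomologicalComplex c).obj K).ExactAt i :=
  ShortComplex.Exact.map h F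

theorem exactAt_map_iff (K : HomologicalComplex C c) (i : ι) (F : C ⥤ D)
    [F.Additive] [PreservesFiniteLimits F] [PreservesFiniteColimits F] [F.Faithful] :
    ((F.mapHomologicalComplex c).obj K).ExactAt i ↔ K.ExactAt i :=
  ShortComplex.exact_map_iff_of_faithful (K.sc i) F

end MapExact

/-! ### The first derived functor as the kernel of `α` -/

section Connecting

variable {C D : Type*} [Category* C] [Category* D] [Abelian C] [Abelian D]
  {F₁ F₂ F₃ : C ⥤ D} [F₁.Additive] [F₂.Additive] [F₃.Additive]
  (α : F₁ ⟶ F₂) (β : F₂ ⟶ F₃) (w : α ≫ β = 0)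

/-- The short complex of complexes obtained by applying a short complex of functors to a
complex. -/
@[simps]
def mapShortComplex {ι : Type*} {c : ComplexShape ι} (K : HomologicalComplex C c) :
    ShortComplex (HomologicalComplex D c) where
  X₁ := (F₁.mapHomologicalComplex c).obj K
  X₂ := (F₂.mapHomologicalComplex c).obj K
  X₃ := (F₃.mapHomologicalComplex c).obj K
  f := (NatTrans.mapHomologicalComplex α c).app K
  g := (NatTrans.mapHomologicalComplex β c).app K
  zero := by
    ext i
    exact congr_app w (K.X i)

/-- `mapShortComplex` is functorial in the complex. -/
@[simps]
def mapShortComplexMap {ι : Type*} {c : ComplexShape ι} {K L : HomologicalComplex C c}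
    (f : K ⟶ L) : mapShortComplex α β w K ⟶ mapShortComplex α β w L where
  τ₁ := (F₁.mapHomologicalComplex c).map f
  τ₂ := (F₂.mapHomologicalComplex c).map f
  τ₃ := (F₃.mapHomologicalComplex c).map f
  comm₁₂ := (NatTrans.mapHomologicalComplex α c).naturality f
  comm₂₃ := (NatTrans.mapHomologicalComplex β c).naturality f

variable {α β w}

/-- The condition that `F₁ → F₂ → F₃` is short exact on projective objects. -/
def ShortExactOnProjectives (α : F₁ ⟶ F₂) (β : F₂ ⟶ F₃) (w : α ≫ β = 0) : Prop :=
  ∀ P : C, Projective P → (ShortComplex.mk (α.app P) (β.app P) (congr_app w P)).ShortExact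

theorem ShortExactOnProjectives.shortExact (h : ShortExactOnProjectives α β w) {ι : Type*}
    {c : ComplexShape ι} (K : HomologicalComplex C c) (hK : ∀ i, Projective (K.X i)) :
    (mapShortComplex α β w K).ShortExact :=
  shortExact_of_degreewise_shortExact _ fun i => h (K.X i) (hK i)

section

variable {ι : Type*} {c : ComplexShape ι} (h : ShortExactOnProjectives α β w)
  {K L : HomologicalComplex C c} (hK : ∀ i, Projective (K.X i)) (hL : ∀ i, Projective (L.X i))
  (φ : K ⟶ L) (i j : ι) (hij : c.Rel i j)

/-- The connecting morphism `Hᵢ(F₃ K) ⟶ Hⱼ(F₁ K)` for a complex `K` of projective objects. -/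
def homologyδ : ((F₃.mapHomologicalComplex c).obj K).homology i ⟶
    ((F₁.mapHomologicalComplex c).obj K).homology j :=
  (h.shortExact K hK).δ i j hij

theorem homologyδ_naturality :
    homologyδ h hK i j hij ≫ homologyMap ((F₁.mapHomologicalComplex c).map φ) j =
      homologyMap ((F₃.mapHomologicalComplex c).map φ) i ≫ homologyδ h hL i j hij :=
  HomologicalComplex.HomologySequence.δ_naturality (mapShortComplexMap α β w φ)
    (h.shortExact K hK) (h.shortExact L hL) i j hij

theorem homologyδ_comp :
    homologyδ h hK i j hij ≫ homologyMap ((NatTrans.mapHomologicalComplex α c).app K) j = 0 :=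
  (h.shortExact K hK).δ_comp i j hij

theorem exact_homologyδ :
    (ShortComplex.mk _ _ (homologyδ_comp h hK i j hij)).Exact :=
  (h.shortExact K hK).homology_exact₁ i j hij

theorem mono_homologyδ (hi : ((F₂.mapHomologicalComplex c).obj K).ExactAt i) :
    Mono (homologyδ h hK i j hij) :=
  (h.shortExact K hK).mono_δ i j hij hi.isZero_homology

end

/-- The comparison of the degree zero homology with the value of a functor. -/
def homologyZeroTo (F : C ⥤ D) [F.Additive] {X : C} (P : ProjectiveResolution X) :
    ((F.mapHomologicalComplex _).obj P.complex).homology 0 ⟶ F.obj X :=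
  homologyι _ 0 ≫ P.fromLeftDerivedZero' F

instance (F : C ⥤ D) [F.Additive] [PreservesFiniteColimits F] {X : C}
    (P : ProjectiveResolution X) : IsIso (homologyZeroTo F P) :=
  have : IsIso (((F.mapHomologicalComplex _).obj P.complex).homologyι 0) :=
    (ChainComplex.isoHomologyι₀ _).isIso_hom
  IsIso.comp_isIso

theorem homologyZeroTo_naturality (F : C ⥤ D) [F.Additive] {X Y : C} (f : X ⟶ Y)
    (P : ProjectiveResolution X) (Q : ProjectiveResolution Y) (φ : P.complex ⟶ Q.complex)
    (comm : φ.f 0 ≫ Q.π.f 0 = P.π.f 0 ≫ f) :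
    homologyMap ((F.mapHomologicalComplex _).map φ) 0 ≫ homologyZeroTo F Q =
      homologyZeroTo F P ≫ F.map f := by
  have h₂ := ProjectiveResolution.fromLeftDerivedZero'_naturality f P Q φ comm F
  rw [homologyZeroTo, homologyι_naturality_assoc, h₂, homologyZeroTo, Category.assoc]

theorem homologyZeroTo_app {X : C} (P : ProjectiveResolution X) :
    homologyMap ((NatTrans.mapHomologicalComplex α _).app P.complex) 0 ≫ homologyZeroTo F₂ P =
      homologyZeroTo F₁ P ≫ α.app X := by
  have : opcyclesMap ((NatTrans.mapHomologicalComplex α _).app P.complex) 0 ≫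
      P.fromLeftDerivedZero' F₂ = P.fromLeftDerivedZero' F₁ ≫ α.app X := by
    rw [← cancel_epi (pOpcycles _ _), p_opcyclesMap_assoc,
      ProjectiveResolution.pOpcycles_comp_fromLeftDerivedZero',
      ProjectiveResolution.pOpcycles_comp_fromLeftDerivedZero'_assoc]
    exact (α.naturality _).symm
  rw [homologyZeroTo, homologyι_naturality_assoc, this, homologyZeroTo, Category.assoc]

variable [HasProjectiveResolutions C]

/-- The computation of the first left derived functor by the chosen projective resolution. -/
def leftDerivedOneIso (F : C ⥤ D) [F.Additive] (X : C) : (F.leftDerived 1).obj X ≅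
    ((F.mapHomologicalComplex _).obj (projectiveResolution X).complex).homology 1 :=
  (projectiveResolution X).isoLeftDerivedObj F 1

theorem leftDerivedOneIso_hom_naturality (F : C ⥤ D) [F.Additive] {X Y : C} (f : X ⟶ Y) :
    (F.leftDerived 1).map f ≫ (leftDerivedOneIso F Y).hom = (leftDerivedOneIso F X).hom ≫
      homologyMap ((F.mapHomologicalComplex _).map (ProjectiveResolution.lift f _ _)) 1 :=
  ProjectiveResolution.isoLeftDerivedObj_hom_naturality f (projectiveResolution X)
      (projectiveResolution Y) (ProjectiveResolution.lift f _ _)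
      (ProjectiveResolution.lift_commutes_zero f _ _) F 1

/-- The connecting natural transformation `L₁F₃ ⟶ F₁`. -/
def connectingHom (h : ShortExactOnProjectives α β w) : F₃.leftDerived 1 ⟶ F₁ where
  app X := (leftDerivedOneIso F₃ X).hom ≫
    homologyδ h (projectiveResolution X).projective 1 0 (by simp) ≫ homologyZeroTo F₁ _
  naturality X Y f := by
    rw [reassoc_of% leftDerivedOneIso_hom_naturality F₃ f,
      ← reassoc_of% homologyδ_naturality h (projectiveResolution X).projective
        (projectiveResolution Y).projective,
      homologyZeroTo_naturality F₁ f _ _ _ (ProjectiveResolution.lift_commutes_zero f _ _)]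
    simp only [Category.assoc]

theorem connectingHom_comp (h : ShortExactOnProjectives α β w) :
    connectingHom h ≫ α = 0 := by
  ext X
  dsimp only [connectingHom, NatTrans.comp_app, NatTrans.app_zero]
  rw [Category.assoc, Category.assoc, ← homologyZeroTo_app,
    reassoc_of% homologyδ_comp h, zero_comp, comp_zero]

variable [PreservesFiniteColimits F₁] [PreservesFiniteColimits F₂]

/-- The end `H₁(F₃ P) ⟶ H₀(F₁ P) ⟶ H₀(F₂ P)` of the long exact sequence of a projective resolution
`P`; right exactness identifies the last two terms with `F₁ X` and `F₂ X`. -/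
theorem exact_connectingHom_app (h : ShortExactOnProjectives α β w) (X : C) :
    (ShortComplex.mk _ _ (congr_app (connectingHom_comp h) X)).Exact := by
  refine ShortComplex.exact_of_iso ?_
    (exact_homologyδ h (projectiveResolution X).projective 1 0 (by simp))
  exact ShortComplex.isoMk (leftDerivedOneIso F₃ X).symm (asIso (homologyZeroTo F₁ _))
    (asIso (homologyZeroTo F₂ _)) (by simp [connectingHom]) (homologyZeroTo_app _).symm

variable [PreservesFiniteLimits F₂]

/-- The preceding term of the long exact sequence, `H₁(F₂ P)`, vanishes because `F₂` is exact. -/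
theorem mono_connectingHom_app (h : ShortExactOnProjectives α β w) (X : C) :
    Mono ((connectingHom h).app X) := by
  have := mono_homologyδ h (projectiveResolution X).projective 1 0 (by simp)
    (exactAt_map ((projectiveResolution X).complex_exactAt_succ 0) F₂)
  exact mono_comp _ (_ ≫ _)

/-- Inherited from the additive functor `F₁`, into which `L₁F₃` embeds naturally. Additivity is what
allows cones to be split termwise later. -/
theorem leftDerived_one_additive (h : ShortExactOnProjectives α β w) :
    (F₃.leftDerived 1).Additive where
  map_add {X Y f g} := by
    have := mono_connectingHom_app h Y
    rw [← cancel_mono ((connectingHom h).app Y), Preadditive.add_comp]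
    simp only [NatTrans.naturality, F₁.map_add, Preadditive.comp_add]

theorem isZero_leftDerived_one_of_mono (h : ShortExactOnProjectives α β w) (X : C)
    [Mono (α.app X)] : IsZero ((F₃.leftDerived 1).obj X) := by
  have := mono_connectingHom_app h X
  rw [IsZero.iff_id_eq_zero, ← cancel_mono ((connectingHom h).app X), ← cancel_mono (α.app X)]
  have := congr_app (connectingHom_comp h) X
  dsimp at this ⊢
  rw [Category.assoc, this]
  simp

end Connecting

theorem isBoundedAbove_mappingCone {C : Type*} [Category* C] [Abelian C]
    {P K : CochainComplex C ℤ} (f : P ⟶ K) (hP : IsBoundedAbove P) (hK : IsBoundedAbove K) :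
    IsBoundedAbove (CochainComplex.mappingCone f) := by
  obtain ⟨m, hm⟩ := hP
  obtain ⟨n, hn⟩ := hK
  refine ⟨max m n, ?_⟩
  rw [CochainComplex.isStrictlyLE_iff]
  intro i hi
  rw [IsZero.iff_id_eq_zero, ← CochainComplex.mappingCone.id_X f i (i + 1) rfl,
    (P.isZero_of_isStrictlyLE m (i + 1) (by lia)).eq_zero_of_tgt
      ((CochainComplex.mappingCone.fst f).1.v i (i + 1) rfl),
    (K.isZero_of_isStrictlyLE n i (by lia)).eq_zero_of_tgt
      ((CochainComplex.mappingCone.snd f).v i i (add_zero i))]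
  simp

/-! ### Vanishing of the first derived functor on opcycles -/

section

variable {C D : Type*} [Category* C] [Category* D] [Abelian C] [Abelian D]
  {F₁ F₂ F₃ : C ⥤ D} [F₁.Additive] [F₂.Additive] [F₃.Additive] [PreservesFiniteColimits F₁]
  [PreservesFiniteColimits F₂] [PreservesFiniteLimits F₂]
  {α : F₁ ⟶ F₂} {β : F₂ ⟶ F₃} {w : α ≫ β = 0}

/-- For a complex `P` of projective objects whose image by `F₃` is exact in degree `n - 1`, the
morphism `α` is a monomorphism on the opcycles of `P` in degree `n`. -/
theorem ShortExactOnProjectives.mono_app_opcycles (h : ShortExactOnProjectives α β w)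
    (hβ : ∀ X, Epi (β.app X))
    (hex : ∀ X, (ShortComplex.mk (α.app X) (β.app X) (congr_app w X)).Exact)
    {P : CochainComplex C ℤ} (hP : ∀ i, Projective (P.X i)) {n : ℤ}
    (hn : ((F₃.mapHomologicalComplex _).obj P).ExactAt (n - 1)) :
    Mono (α.app (P.opcycles n)) := by
  have hc : (ShortComplex.mk (P.d (n - 1) n) (P.pOpcycles n) (by simp)).Exact :=
    ShortComplex.exact_of_g_is_cokernel _ (P.opcyclesIsCokernel (n - 1) n (by simp))
  have hG : (ShortComplex.mk (F₂.map (P.d (n - 1) n)) (F₂.map (P.pOpcycles n))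
      (by rw [← F₂.map_comp]; simp)).Exact := hc.map F₂
  have hn' : (ShortComplex.mk (F₃.map (P.d (n - 2) (n - 1))) (F₃.map (P.d (n - 1) n))
      (by rw [← F₃.map_comp]; simp)).Exact :=
    (exactAt_iff' _ (n - 2) (n - 1) n (by simp; lia) (by simp)).1 hn
  have := (h _ (hP n)).mono_f
  dsimp at this
  rw [Preadditive.mono_iff_cancel_zero]
  intro A x hx
  -- Chase: lift `x` to `x₀` in `F₁ Pₙ`; then `α x₀ = d y` in `F₂ Pₙ`. As `β y` is a cycle, it is `d
  -- z'`, and `z'` lifts to `z`. Now `y - d z = α t`, so `α x₀ = α (d t)`, hence `x₀ = d t` and `x =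
  -- 0`.
  obtain ⟨A₀, π₀, _, x₀, hx₀⟩ := surjective_up_to_refinements_of_epi
    (F₁.map (P.pOpcycles n)) x
  obtain ⟨A₁, π₁, _, y, hy⟩ := hG.exact_up_to_refinements (x₀ ≫ α.app _) (by
    dsimp only
    rw [Category.assoc, ← α.naturality, ← reassoc_of% hx₀, hx, comp_zero])
  dsimp only at y hy
  obtain ⟨A₂, π₂, _, z', hz'⟩ := hn'.exact_up_to_refinements (y ≫ β.app _) (by
    have : α.app (P.X n) ≫ β.app (P.X n) = 0 := congr_app w (P.X n)
    dsimp only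
    rw [Category.assoc, ← β.naturality, ← reassoc_of% hy, this, comp_zero, comp_zero])
  dsimp only at z' hz'
  have := hβ (P.X (n - 2))
  obtain ⟨A₃, π₃, _, z, hz⟩ := surjective_up_to_refinements_of_epi (β.app (P.X (n - 2))) z'
  obtain ⟨A₄, π₄, _, t, ht⟩ := (hex _).exact_up_to_refinements
    (π₃ ≫ π₂ ≫ y - z ≫ F₂.map (P.d (n - 2) (n - 1))) (by
      dsimp only
      rw [Preadditive.sub_comp, Category.assoc, Category.assoc, Category.assoc, hz',
        β.naturality, reassoc_of% hz, sub_self])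
  dsimp only at t ht
  have key : π₄ ≫ π₃ ≫ π₂ ≫ π₁ ≫ x₀ = t ≫ F₁.map (P.d (n - 1) n) := by
    rw [← cancel_mono (α.app (P.X n)), Category.assoc t, α.naturality, ← reassoc_of% ht]
    simp only [Category.assoc, Preadditive.sub_comp, ← F₂.map_comp, d_comp_d, F₂.map_zero,
      comp_zero, sub_zero, hy]
  rw [← cancel_epi (π₄ ≫ π₃ ≫ π₂ ≫ π₁ ≫ π₀)]
  simp only [Category.assoc, hx₀, comp_zero]
  have key' := key =≫ F₁.map (P.pOpcycles n)
  rw [Category.assoc t, ← Functor.map_comp, P.d_pOpcycles, Functor.map_zero, comp_zero] at key'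
  simpa only [Category.assoc] using key'

end

/-! ### Consequences of the sequence `S F ⟶ G ⟶ F` -/

section SquareZero

variable {C D : Type*} [Category* C] [Category* D] [Abelian C] [Abelian D]
  {F G : C ⥤ D} {S : D ⥤ D} [G.Additive] [S.Additive] {α : F ⋙ S ⟶ G} {β : G ⟶ F} {w : α ≫ β = 0}

/-- If `F ⋙ S ⟶ G ⟶ F` is exact with `G` faithful, then the composition of two morphisms which
are annihilated by `F` is zero. -/
theorem comp_eq_zero_of_map_eq_zero [G.Faithful]
    (hex : ∀ X, (ShortComplex.mk (α.app X) (β.app X) (congr_app w X)).Exact)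
    {X Y Z : C} {f : X ⟶ Y} {g : Y ⟶ Z} (hf : F.map f = 0) (hg : F.map g = 0) : f ≫ g = 0 := by
  apply G.map_injective
  -- Locally `G f` factors through `α`, and naturality of `α` turns the composite with `G g` into
  -- one through `S (F g) = 0`.
  obtain ⟨A, π, _, x, hx⟩ := (hex Y).exact_up_to_refinements (G.map f) (by
    dsimp
    rw [β.naturality, hf, comp_zero])
  dsimp at hx
  rw [← cancel_epi π, G.map_comp, reassoc_of% hx, ← α.naturality, Functor.comp_map, hg]
  simp

variable [F.Additive] [PreservesFiniteColimits G] [PreservesFiniteLimits G]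
  [PreservesFiniteColimits S] [PreservesFiniteLimits S]

/-- A form of Nakayama's lemma for a nilpotent ideal: both ends of `0 ⟶ S F K ⟶ G K ⟶ F K ⟶ 0` are
exact in degree `i`, hence so is the middle, and `G` reflects exactness. -/
theorem ShortExactOnProjectives.exactAt [G.Faithful] (h : ShortExactOnProjectives α β w)
    {ι : Type*} {c : ComplexShape ι} {K : HomologicalComplex C c} (hK : ∀ i, Projective (K.X i))
    {i : ι} (hi : ((F.mapHomologicalComplex c).obj K).ExactAt i) : K.ExactAt i :=
  (exactAt_map_iff K i G).1 ((h.shortExact K hK).exactAt_X₂ i (exactAt_map hi S) hi)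

variable [PreservesFiniteColimits F] [HasProjectiveResolutions C]

/-- The complex obtained by applying the first left derived functor of `F` termwise. -/
def leftDerivedOne (h : ShortExactOnProjectives α β w) {ι : Type*} {c : ComplexShape ι}
    (K : HomologicalComplex C c) : HomologicalComplex D c :=
  have := leftDerived_one_additive h
  ((F.leftDerived 1).mapHomologicalComplex c).obj K

theorem exactAt_map_iff_leftDerivedOne (h : ShortExactOnProjectives α β w)
    (hβ : ∀ X, Epi (β.app X))
    (hex : ∀ X, (ShortComplex.mk (α.app X) (β.app X) (congr_app w X)).Exact)
    {K : CochainComplex C ℤ} (hK : K.Acyclic) (j₀ j₁ j₂ : ℤ) (h₀₁ : j₀ + 1 = j₁)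
    (h₁₂ : j₁ + 1 = j₂) (hj₁ : ((F.mapHomologicalComplex _).obj K).ExactAt j₁)
    (hj₂ : ((F.mapHomologicalComplex _).obj K).ExactAt j₂) :
    ((F.mapHomologicalComplex _).obj K).ExactAt j₀ ↔ (leftDerivedOne h K).ExactAt j₂ := by
  have := leftDerived_one_additive h
  let θ' := (NatTrans.mapHomologicalComplex (connectingHom h) (ComplexShape.up ℤ)).app K
  let α' := (NatTrans.mapHomologicalComplex α (ComplexShape.up ℤ)).app K
  let β' := (NatTrans.mapHomologicalComplex β (ComplexShape.up ℤ)).app K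
  have : Mono θ' := mono_of_mono_f _ fun i => mono_connectingHom_app h (K.X i)
  have : Epi β' := epi_of_epi_f _ fun i => hβ (K.X i)
  refine exactAt_iff_of_exact θ' α' β' ?_ (mapShortComplex α β w K).zero ?_ ?_
    (fun i => exactAt_map (hK i) G) j₀ j₁ j₂ h₀₁ h₁₂ (exactAt_map hj₁ S) (exactAt_map hj₂ S)
  · ext i
    exact congr_app (connectingHom_comp h) (K.X i)
  · exact exact_of_degreewise_exact _ fun i => exact_connectingHom_app h (K.X i)
  · exact exact_of_degreewise_exact _ fun i => hex (K.X i)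

/-- For an acyclic bounded above complex `K`, the exactness of `F K` in all degrees `≥ a` amounts
to the exactness of `L₁F K` in all degrees `≥ a + 2`. -/
theorem forall_exactAt_map_iff (h : ShortExactOnProjectives α β w)
    (hβ : ∀ X, Epi (β.app X))
    (hex : ∀ X, (ShortComplex.mk (α.app X) (β.app X) (congr_app w X)).Exact)
    {K : CochainComplex C ℤ} (hK : K.Acyclic) (hK' : IsBoundedAbove K) (a : ℤ) :
    (∀ j, a ≤ j → ((F.mapHomologicalComplex _).obj K).ExactAt j) ↔
      ∀ j, a ≤ j → (leftDerivedOne h K).ExactAt (j + 2) := by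
  have step := exactAt_map_iff_leftDerivedOne h hβ hex hK
  constructor
  · intro H j hj
    exact (step j (j + 1) (j + 2) rfl (by lia) (H _ (by lia)) (H _ (by lia))).1 (H j hj)
  · intro H
    obtain ⟨m, hm⟩ := hK'
    -- Descending induction on the degree, starting at `m + 1`, above which the complex is zero.
    have (n : ℕ) : ∀ j, a ≤ j → m + 1 - n ≤ j →
        ((F.mapHomologicalComplex _).obj K).ExactAt j := by
      induction n with
      | zero =>
        intro j _ hj
        exact ExactAt.of_isZero (F.map_isZero (K.isZero_of_isStrictlyLE m j (by lia)))
      | succ n ih =>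
        intro j hj hj'
        exact (step j (j + 1) (j + 2) rfl (by lia) (ih _ (by lia) (by lia))
          (ih _ (by lia) (by lia))).2 (H j hj)
    intro j hj
    exact this (m + 1 - j).natAbs j hj (by lia)

theorem isZero_leftDerived_one_projective (F : C ⥤ D) [F.Additive] (X : C) [Projective X] :
    IsZero ((F.leftDerived 1).obj X) :=
  F.isZero_leftDerived_obj_projective_succ 0 X

set_option linter.unusedSectionVars false in
/-- The termwise first left derived functor does not see complexes of projective objects. -/
theorem exactAt_leftDerivedOne_mappingCone_iff (h : ShortExactOnProjectives α β w)
    {P K : CochainComplex C ℤ} (f : P ⟶ K) (hP : ∀ i, Projective (P.X i)) (i : ℤ) :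
    (leftDerivedOne h (CochainComplex.mappingCone f)).ExactAt i ↔
      (leftDerivedOne h K).ExactAt i := by
  have := leftDerived_one_additive h
  let T := F.leftDerived 1
  -- In each degree the cone is a term of `P` plus a term of `K`, and `T` kills the former; so the
  -- inclusion of `K` becomes an isomorphism.
  have hiso (n : ℤ) : IsIso (T.map ((CochainComplex.mappingCone.inr f).f n)) := by
    refine ⟨T.map ((CochainComplex.mappingCone.snd f).v n n (add_zero n)), ?_, ?_⟩
    · rw [← T.map_comp]
      simp
    · have h₁ := CochainComplex.mappingCone.id_X f n (n + 1) rfl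
      have h₂ := isZero_leftDerived_one_projective F (P.X (n + 1))
      rw [← T.map_comp, ← T.map_id, ← h₁, T.map_add,
        T.map_comp ((CochainComplex.mappingCone.fst f).1.v n (n + 1) rfl),
        h₂.eq_zero_of_tgt (T.map ((CochainComplex.mappingCone.fst f).1.v n (n + 1) rfl)),
        zero_comp, zero_add]
  have : ∀ n, IsIso (((T.mapHomologicalComplex (ComplexShape.up ℤ)).map
    (CochainComplex.mappingCone.inr f)).f n) := hiso
  have := HomologicalComplex.Hom.isIso_of_components ((T.mapHomologicalComplex
    (ComplexShape.up ℤ)).map (CochainComplex.mappingCone.inr f))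
  exact (exactAt_iff_of_iso (asIso ((T.mapHomologicalComplex
    (ComplexShape.up ℤ)).map (CochainComplex.mappingCone.inr f))) i).symm

/-- Comparison of a complex `K` with a resolution `P` by projective objects after application
of `F`. -/
theorem forall_exactAt_mappingCone_map_iff (h : ShortExactOnProjectives α β w)
    (hβ : ∀ X, Epi (β.app X))
    (hex : ∀ X, (ShortComplex.mk (α.app X) (β.app X) (congr_app w X)).Exact)
    {P K : CochainComplex C ℤ} (f : P ⟶ K) [QuasiIso f] (hP : ∀ i, Projective (P.X i))
    (hP' : IsBoundedAbove P) (hK' : IsBoundedAbove K) (a : ℤ) :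
    (∀ j, a ≤ j →
      (CochainComplex.mappingCone ((F.mapHomologicalComplex _).map f)).ExactAt j) ↔
      ∀ j, a ≤ j → (leftDerivedOne h K).ExactAt (j + 2) := by
  have h₁ := forall_exactAt_map_iff h hβ hex ((acyclic_mappingCone_iff f).2 inferInstance)
    (isBoundedAbove_mappingCone f hP' hK') a
  simp only [exactAt_leftDerivedOne_mappingCone_iff h f hP] at h₁
  rw [← h₁]
  exact forall_congr' fun j => imp_congr_right fun _ =>
    (exactAt_iff_of_iso (CochainComplex.mappingCone.mapHomologicalComplexIso f F) j).symm

end SquareZero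

/-! ### Lifting a homotopy equivalence by deforming a differential -/

section Perturbation

variable {C D : Type*} [Category* C] [Category* D] [Preadditive C] [Preadditive D]
  {ι : Type*} {c : ComplexShape ι} (P Q : HomologicalComplex C c)

/-- The failure of a family of morphisms `Q.X i ⟶ P.X i` to be a morphism of complexes. -/
def defect (g : ∀ i, Q.X i ⟶ P.X i) (i j : ι) : Q.X i ⟶ P.X j :=
  g i ≫ P.d i j - Q.d i j ≫ g j

variable {P Q}

theorem defect_eq_zero (g : ∀ i, Q.X i ⟶ P.X i) (i j : ι) (h : ¬ c.Rel i j) :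
    defect P Q g i j = 0 := by
  simp [defect, P.shape _ _ h, Q.shape _ _ h]

theorem defect_comp_d (g : ∀ i, Q.X i ⟶ P.X i) (i j k : ι) :
    defect P Q g i j ≫ P.d j k = -(Q.d i j ≫ defect P Q g j k) := by
  simp [defect]

variable {F : C ⥤ D} [F.Additive]
  (hF : ∀ ⦃X Y Z : C⦄ (f : X ⟶ Y) (g : Y ⟶ Z), F.map f = 0 → F.map g = 0 → f ≫ g = 0)
  (g : ∀ i, Q.X i ⟶ P.X i) (hg : ∀ i j, F.map (defect P Q g i j) = 0)
  (f : ∀ i, P.X i ⟶ Q.X i)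
  (hf : ∀ i j, F.map (f i ≫ Q.d i j) = F.map (P.d i j ≫ f j))

/-- The deformation of the differential of `Q` which makes a family of morphisms
`Q.X i ⟶ P.X i` a morphism of complexes after a correction. -/
@[simps]
def deform : HomologicalComplex C c where
  X := Q.X
  d i j := Q.d i j + defect P Q g i j ≫ f j
  shape i j h := by simp [defect_eq_zero g i j h, Q.shape i j h]
  d_comp_d' i j k _ _ := by
    -- With `δ` the defect, `(d + δf)²` is `dδf + δfd + δfδf`. The last term is a product of two
    -- maps killed by `F`; the others cancel since `δ(fd - df) = 0` and `δd = -dδ`.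
    have h₁ : defect P Q g i j ≫ (f j ≫ Q.d j k - P.d j k ≫ f k) = 0 :=
      hF _ _ (hg i j) (by rw [F.map_sub, hf, sub_self])
    have h₂ : (defect P Q g i j ≫ f j) ≫ defect P Q g j k = 0 :=
      hF _ _ (by rw [F.map_comp, hg, zero_comp]) (hg j k)
    rw [Preadditive.comp_sub, reassoc_of% defect_comp_d g i j k, Preadditive.neg_comp,
      sub_neg_eq_add] at h₁
    simp only [Preadditive.add_comp, Preadditive.comp_add, d_comp_d, zero_add,
      ← Category.assoc (defect P Q g i j ≫ f j), h₂, zero_comp, add_zero]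
    rw [← h₁]
    simp only [Category.assoc]

variable (s : ∀ i j, P.X i ⟶ P.X j)
  (hs : ∀ i j, c.Rel i j →
    F.map (f j ≫ g j) = F.map (P.d j (c.next j) ≫ s (c.next j) j) + F.map (s j i ≫ P.d i j) +
      F.map (𝟙 (P.X j)))

/-- The morphism from the deformed complex. -/
@[simps]
def deformHom : deform hF g hg f hf ⟶ P where
  f i := g i + defect P Q g i (c.next i) ≫ s (c.next i) i
  comm' i j hij := by
    -- The homotopy identity `fg = ds + sd + 1` holds only after `F`, but becomes exact once
    -- precomposed with `δ`. Its term `δ` cancels the failure of `g` to commute with `d`.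
    have h₁ : defect P Q g i j ≫ (f j ≫ g j - P.d j (c.next j) ≫ s (c.next j) j -
        s j i ≫ P.d i j - 𝟙 (P.X j)) = 0 :=
      hF _ _ (hg i j) (by rw [F.map_sub, F.map_sub, F.map_sub, hs i j hij]; abel)
    have h₂ : (defect P Q g i j ≫ f j) ≫ defect P Q g j (c.next j) = 0 :=
      hF _ _ (by rw [F.map_comp, hg, zero_comp]) (hg j _)
    have h₃ : g i ≫ P.d i j = Q.d i j ≫ g j + defect P Q g i j := by
      simp [defect]
    obtain rfl := c.next_eq' hij
    simp only [Preadditive.comp_sub, reassoc_of% defect_comp_d g, Preadditive.neg_comp,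
      Category.comp_id, sub_neg_eq_add] at h₁
    change (g i + defect P Q g i (c.next i) ≫ s (c.next i) i) ≫ P.d i (c.next i) =
      (Q.d i (c.next i) + defect P Q g i (c.next i) ≫ f (c.next i)) ≫
        (g (c.next i) + defect P Q g (c.next i) (c.next (c.next i)) ≫ s _ _)
    simp only [Preadditive.add_comp, Preadditive.comp_add, Category.assoc, h₃] at h₂ ⊢
    rw [reassoc_of% h₂, zero_comp, add_zero]
    rw [sub_eq_zero, sub_eq_iff_eq_add] at h₁
    have h₄ := eq_sub_of_add_eq h₁
    rw [h₄, Category.assoc]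
    abel

/-- Let `F` be a functor such that any two composable morphisms annihilated by `F` have zero
composition. If `F P` is homotopy equivalent to `F Q` and morphisms can be lifted along `F`, then
the differential of `Q` can be deformed so that the homotopy equivalence lifts to a morphism. -/
theorem exists_lift_of_homotopyEquiv
    (hF : ∀ ⦃X Y Z : C⦄ (f : X ⟶ Y) (g : Y ⟶ Z), F.map f = 0 → F.map g = 0 → f ≫ g = 0)
    (hP : ∀ i Y, Function.Surjective (F.map : (P.X i ⟶ Y) → _))
    (hQ : ∀ i Y, Function.Surjective (F.map : (Q.X i ⟶ Y) → _))
    (e : HomotopyEquiv ((F.mapHomologicalComplex c).obj P) ((F.mapHomologicalComplex c).obj Q)) :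
    ∃ (Q' : HomologicalComplex C c) (_ : ∀ i, Nonempty (Q'.X i ≅ Q.X i)) (g : Q' ⟶ P)
      (φ : (F.mapHomologicalComplex c).obj Q' ≅ (F.mapHomologicalComplex c).obj Q),
      (F.mapHomologicalComplex c).map g = φ.hom ≫ e.inv := by
  choose g hg' using fun i => hQ i _ (e.inv.f i)
  choose f hf' using fun i => hP i _ (e.hom.f i)
  choose s hs' using fun i j => hP i _ (e.homotopyHomInvId.hom i j)
  have hg (i j : ι) : F.map (defect P Q g i j) = 0 := by
    rw [defect, F.map_sub, F.map_comp, F.map_comp, hg', hg', sub_eq_zero]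
    exact e.inv.comm i j
  have hf (i j : ι) : F.map (f i ≫ Q.d i j) = F.map (P.d i j ≫ f j) := by
    rw [F.map_comp, F.map_comp, hf', hf']
    exact e.hom.comm i j
  have hs (i j : ι) (hij : c.Rel i j) : F.map (f j ≫ g j) =
      F.map (P.d j (c.next j) ≫ s (c.next j) j) + F.map (s j i ≫ P.d i j) +
        F.map (𝟙 (P.X j)) := by
    have := e.homotopyHomInvId.comm j
    rw [prevD_eq _ hij] at this
    simp only [F.map_comp, hf', hg', hs', F.map_id]
    exact this
  refine ⟨deform hF g hg f hf, fun i => ⟨Iso.refl _⟩, deformHom hF g hg f hf s hs,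
    Hom.isoOfComponents (fun i => Iso.refl _) fun i j _ => ?_, ?_⟩
  · have : F.map (Q.d i j + defect P Q g i j ≫ f j) = F.map (Q.d i j) := by
      rw [F.map_add, F.map_comp, hg, zero_comp, add_zero]
    exact (Category.id_comp _).trans (this.symm.trans (Category.comp_id _).symm)
  · ext i
    have : F.map (g i + defect P Q g i (c.next i) ≫ s (c.next i) i) = F.map (g i) := by
      rw [F.map_add, F.map_comp, hg, zero_comp, add_zero]
    exact (this.trans (hg' i)).trans (Category.id_comp _).symm

end Perturbation

end DerivedPullback

end

/-! ### The sequence `I ⊗ (V ⊗_B A) ⟶ V ⟶ V ⊗_B A` for a split extension -/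

noncomputable section

namespace DerivedPullback

open Limits HomologicalComplex MonoidalCategory TensorProduct

/-- A split square-zero extension of commutative rings. -/
structure SplitExtension (A B I : Type u) [CommRing A] [CommRing B] [AddCommGroup I]
    [Module A I] where
  /-- the inclusion of the ideal -/
  ι : I →+ B
  /-- the projection -/
  π : B →+* A
  /-- the section -/
  σ : A →+* B
  ι_injective : Function.Injective ι
  exact : Function.Exact ι π
  smul_eq : ∀ (b : B) (i : I), ι (π b • i) = b * ι i
  π_σ : π.comp σ = RingHom.id A

namespace SplitExtension

variable {A B I : Type u} [CommRing A] [CommRing B] [AddCommGroup I] [Module A I]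
  (E : SplitExtension A B I)

/-- The restriction of scalars along the section. -/
abbrev res : ModuleCat.{u} B ⥤ ModuleCat.{u} A := ModuleCat.restrictScalars.{u} E.σ

/-- The tensor product with the ideal. -/
abbrev tensorIdeal (A I : Type u) [CommRing A] [AddCommGroup I] [Module A I] :
    ModuleCat.{u} A ⥤ ModuleCat.{u} A := tensorLeft (ModuleCat.of A I)

theorem π_σ_apply (a : A) : E.π (E.σ a) = a := DFunLike.congr_fun E.π_σ a

theorem ι_smul (a : A) (i : I) : E.ι (a • i) = E.σ a * E.ι i := by
  rw [← E.smul_eq, E.π_σ_apply]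

/-- The element `1 ⊗ v` of the base change. -/
def oneTmul {V : ModuleCat.{u} B} (v : V) : (baseChange E.π).obj V :=
  (ModuleCat.extendRestrictScalarsAdj.{u} E.π).unit.app V v

theorem oneTmul_add {V : ModuleCat.{u} B} (v v' : V) :
    E.oneTmul (v + v') = E.oneTmul v + E.oneTmul v' :=
  map_add ((ModuleCat.extendRestrictScalarsAdj.{u} E.π).unit.app V).hom v v'

theorem oneTmul_smul {V : ModuleCat.{u} B} (b : B) (v : V) :
    E.oneTmul (b • v) = E.π b • E.oneTmul v :=
  map_smul ((ModuleCat.extendRestrictScalarsAdj.{u} E.π).unit.app V).hom b v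

/-- A semilinear map induces a linear map on the base change. -/
theorem exists_hom {V : ModuleCat.{u} B} {N : ModuleCat.{u} A} (f : V →+ N)
    (hf : ∀ (b : B) (v : V), f (b • v) = E.π b • f v) :
    ∃ g : (baseChange E.π).obj V ⟶ N, ∀ v, g (E.oneTmul v) = f v := by
  let f' : V ⟶ (ModuleCat.restrictScalars E.π).obj N :=
    ModuleCat.ofHom (Y := (ModuleCat.restrictScalars E.π).obj N)
      { toFun := f, map_add' := map_add f, map_smul' := hf }
  let g := ((ModuleCat.extendRestrictScalarsAdj.{u} E.π).homEquiv _ _).symm f'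
  refine ⟨g, fun v => ?_⟩
  have : (ModuleCat.extendRestrictScalarsAdj.{u} E.π).homEquiv _ _ g v = f v := by
    rw [Equiv.apply_symm_apply]
    rfl
  exact this

theorem oneTmul_surjective (V : ModuleCat.{u} B) :
    Function.Surjective (E.oneTmul (V := V)) := by
  intro x
  induction x using TensorProduct.induction_on with
  | zero => exact ⟨0, map_zero ((ModuleCat.extendRestrictScalarsAdj.{u} E.π).unit.app V).hom⟩
  | tmul a v =>
    refine ⟨(E.σ (show A from a)) • v, (E.oneTmul_smul _ _).trans ?_⟩
    refine (congrArg (· • E.oneTmul v) (E.π_σ_apply a)).trans ?_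
    exact congrArg (· ⊗ₜ[B] v) (mul_one (M := A) a)
  | add x y hx hy =>
    obtain ⟨v, rfl⟩ := hx
    obtain ⟨v', rfl⟩ := hy
    exact ⟨v + v', E.oneTmul_add v v'⟩

/-- The natural surjection from the restriction of scalars to the base change. -/
def β : E.res ⟶ baseChange E.π where
  app V := ModuleCat.ofHom (X := E.res.obj V) (Y := (baseChange E.π).obj V)
    { toFun v := E.oneTmul (V := V) v
      map_add' := E.oneTmul_add
      map_smul' a v := by
        refine (E.oneTmul_smul (V := V) (E.σ a) v).trans ?_
        rw [E.π_σ_apply]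
        rfl }
  naturality V W f := by
    ext v
    rfl

theorem β_app_surjective (V : ModuleCat.{u} B) : Function.Surjective (E.β.app V) :=
  E.oneTmul_surjective V

instance (V : ModuleCat.{u} B) : Epi (E.β.app V) :=
  (ModuleCat.epi_iff_surjective _).2 (E.β_app_surjective V)

/-- The map `v ↦ (i ↦ ι i • v)`. -/
def mulHom (V : ModuleCat.{u} B) : V →+ (I →ₗ[A] E.res.obj V) where
  toFun v :=
    { toFun i := (E.ι i • v : V)
      map_add' i j := by
        rw [map_add]
        exact add_smul (E.ι i) (E.ι j) v
      map_smul' a i := by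
        rw [E.ι_smul]
        exact mul_smul (E.σ a) (E.ι i) v }
  map_zero' := by
    ext i
    exact smul_zero (A := V) (E.ι i)
  map_add' v v' := by
    ext i
    exact smul_add (A := V) (E.ι i) v v'

theorem exists_α (V : ModuleCat.{u} B) :
    ∃ g : (baseChange E.π).obj V ⟶ ModuleCat.of A (I →ₗ[A] E.res.obj V),
      ∀ v, g (E.oneTmul v) = E.mulHom V v := by
  refine E.exists_hom (N := ModuleCat.of A (I →ₗ[A] E.res.obj V)) (E.mulHom V) fun b v => ?_
  ext i
  change E.ι i • b • v = E.σ (E.π b) • E.ι i • v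
  -- `b` and `σ (π b)` have the same product with `ι i`, as both act on `I` through `π b`.
  rw [← mul_smul, ← mul_smul, ← E.smul_eq (E.σ (E.π b)), E.π_σ_apply, E.smul_eq, mul_comm]

/-- The multiplication `I ⊗ (A ⊗ V) ⟶ V`. -/
def αApp (V : ModuleCat.{u} B) :
    (baseChange E.π ⋙ tensorIdeal A I).obj V ⟶ E.res.obj V :=
  let φ : (baseChange E.π).obj V →ₗ[A] I →ₗ[A] E.res.obj V := (E.exists_α V).choose.hom
  ModuleCat.ofHom (X := ModuleCat.of A (I ⊗[A] (baseChange E.π).obj V)) (Y := E.res.obj V)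
    (TensorProduct.lift φ.flip)

theorem αApp_tmul (V : ModuleCat.{u} B) (i : I) (v : V) :
    E.αApp V (i ⊗ₜ[A] E.oneTmul v : I ⊗[A] (baseChange E.π).obj V) = (E.ι i • v : V) := by
  have h := (E.exists_α V).choose_spec v
  exact DFunLike.congr_fun h i

theorem tensor_hom_ext {V : ModuleCat.{u} B} {N : ModuleCat.{u} A}
    {f g : (baseChange E.π ⋙ tensorIdeal A I).obj V ⟶ N}
    (h : ∀ (i : I) (v : V), f (i ⊗ₜ[A] E.oneTmul v : I ⊗[A] (baseChange E.π).obj V) =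
      g (i ⊗ₜ[A] E.oneTmul v : I ⊗[A] (baseChange E.π).obj V)) : f = g := by
  ext : 1
  refine TensorProduct.ext' fun i x => ?_
  obtain ⟨v, rfl⟩ := E.oneTmul_surjective V x
  exact h i v

/-- The multiplication `I ⊗ (A ⊗ V) ⟶ V` as a natural transformation. -/
def α : baseChange E.π ⋙ tensorIdeal A I ⟶ E.res where
  app V := E.αApp V
  naturality V W f := by
    refine E.tensor_hom_ext fun i v => ?_
    refine (E.αApp_tmul W i (f v)).trans ?_
    refine Eq.trans ?_ (congrArg (E.res.map f) (E.αApp_tmul V i v)).symm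
    exact (map_smul f.hom (E.ι i) v).symm

theorem π_ι (i : I) : E.π (E.ι i) = 0 := E.exact.apply_apply_eq_zero i

theorem α_comp_β : E.α ≫ E.β = 0 := by
  ext V : 2
  refine E.tensor_hom_ext fun i v => ?_
  refine (congrArg (E.β.app V) (E.αApp_tmul V i v)).trans ?_
  refine (E.oneTmul_smul (V := V) (E.ι i) v).trans ?_
  rw [E.π_ι, zero_smul]
  rfl

theorem exact_α_β (V : ModuleCat.{u} B) :
    (ShortComplex.mk (E.α.app V) (E.β.app V) (congr_app E.α_comp_β V)).Exact := by
  rw [ShortComplex.moduleCat_exact_iff]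
  intro v hv
  let N : ModuleCat A := ModuleCat.of A (E.res.obj V ⧸ LinearMap.range (E.α.app V).hom)
  let q : E.res.obj V →ₗ[A] N := Submodule.mkQ _
  -- The quotient of `V` by the image of `α` is killed by `I`, so the projection `q` is semilinear
  -- over `π` and factors through the base change.
  obtain ⟨g, hg⟩ := E.exists_hom (V := V) (N := N) q.toAddMonoidHom fun b v => by
    obtain ⟨i, hi⟩ := (E.exact (b - E.σ (E.π b))).1 (by
      rw [map_sub, E.π_σ_apply, sub_self])
    have h₁ : q (E.ι i • v : V) = 0 := by
      refine (Submodule.Quotient.mk_eq_zero _).2 ⟨_, E.αApp_tmul V i v⟩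
    have h₂ : (b • v : V) = (E.ι i • v : V) + (E.σ (E.π b) • v : V) := by
      rw [hi, sub_smul, sub_add_cancel]
    change q (b • v : V) = (E.π b • (q v : N) : N)
    rw [h₂]
    refine (map_add q _ _).trans ?_
    rw [h₁, zero_add]
    exact map_smul q (E.π b) (show E.res.obj V from v)
  have h₁ : q v = 0 := by
    have h₂ : g (E.oneTmul (V := V) v) = q v := hg v
    rw [← h₂]
    exact (congrArg g hv).trans (map_zero g.hom)
  exact (Submodule.Quotient.mk_eq_zero _).1 h₁

/-- After cancelling `A`, the map is `I ⊗_B V ⟶ B ⊗_B V = V`, injective by flatness of `V`. -/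
theorem injective_of_tmul {V : Type u} [AddCommGroup V] [Module B V] [Algebra B A] [Module B I]
    [IsScalarTower B A I] [Module.Flat B V] (j : I →ₗ[B] B) (hj : Function.Injective j)
    (f : I ⊗[A] (A ⊗[B] V) →+ V) (hf : ∀ i v, f (i ⊗ₜ (1 ⊗ₜ v)) = j i • v) :
    Function.Injective f := by
  let e := AlgebraTensorModule.cancelBaseChange B A A I V
  have h : Function.Injective ((TensorProduct.lid B V).toLinearMap ∘ₗ j.rTensor V) :=
    (TensorProduct.lid B V).injective.comp (Module.Flat.rTensor_preserves_injective_linearMap j hj)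
  have he (x : I ⊗[B] V) :
      f (e.symm x) = ((TensorProduct.lid B V).toLinearMap ∘ₗ j.rTensor V) x := by
    induction x using TensorProduct.induction_on with
    | zero => simp
    | tmul i v => simp [e, hf]
    | add x y hx hy => rw [map_add, map_add, map_add, hx, hy]
  have he' (x) : f x = ((TensorProduct.lid B V).toLinearMap ∘ₗ j.rTensor V) (e x) := by
    rw [← he, e.symm_apply_apply]
  intro x y hxy
  rw [he', he'] at hxy
  exact e.injective (h hxy)

theorem mono_α_app (V : ModuleCat.{u} B) [Module.Flat B V] : Mono (E.α.app V) := by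
  rw [ModuleCat.mono_iff_injective]
  let := E.π.toAlgebra
  let : Module B I := Module.compHom I E.π
  have : IsScalarTower B A I := ⟨fun b a i => mul_smul (E.π b) a i⟩
  exact injective_of_tmul (A := A) (V := V) { E.ι with map_smul' := E.smul_eq } E.ι_injective
    (E.αApp V).hom.toAddMonoidHom (E.αApp_tmul V)

theorem shortExactOnProjectives : ShortExactOnProjectives E.α E.β E.α_comp_β := by
  intro V hV
  have : Module.Projective B V := (IsProjective.iff_projective V).2 hV
  have := E.mono_α_app V
  exact { exact := E.exact_α_β V, mono_f := this, epi_g := inferInstance }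

instance : PreservesFiniteColimits (baseChange E.π) :=
  have : PreservesColimitsOfSize.{0, 0} (baseChange E.π) :=
    (ModuleCat.extendRestrictScalarsAdj.{u} E.π).leftAdjoint_preservesColimits
  PreservesColimitsOfSize.preservesFiniteColimits (baseChange E.π)

/-- By adjunction the map is a `B`-linear map from `V` to `W ⊗_B A`, which lifts along the
surjection from `W`. -/
theorem baseChange_map_surjective (V W : ModuleCat.{u} B) [Projective V] :
    Function.Surjective ((baseChange E.π).map : (V ⟶ W) → _) := by
  intro f
  let adj := ModuleCat.extendRestrictScalarsAdj.{u} E.π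
  let η : W ⟶ (ModuleCat.restrictScalars E.π).obj ((baseChange E.π).obj W) := adj.unit.app W
  let f' : V ⟶ (ModuleCat.restrictScalars E.π).obj ((baseChange E.π).obj W) :=
    adj.homEquiv V _ f
  have : Epi η := (ModuleCat.epi_iff_surjective _).2 (E.oneTmul_surjective W)
  obtain ⟨g, hg⟩ := Projective.factors f' η
  refine ⟨g, (adj.homEquiv V _).injective (Eq.trans ?_ hg)⟩
  exact (adj.homEquiv_unit ..).trans (adj.unit.naturality g).symm

end SplitExtension

/-! ### Base change of projective, finite and bounded objects -/

section BaseChange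

variable {A B : Type u} [CommRing A] [CommRing B] (π : B →+* A)

instance (V : ModuleCat.{u} B) [Projective V] : Projective ((baseChange π).obj V) :=
  (ModuleCat.extendRestrictScalarsAdj.{u} π).map_projective V inferInstance

instance (V : ModuleCat.{u} B) [Module.Finite B V] : Module.Finite A ((baseChange π).obj V) := by
  let := π.toAlgebra
  exact inferInstanceAs (Module.Finite A (A ⊗[B] V))

theorem pullback_isBoundedAbove {K : CochainComplex (ModuleCat.{u} B) ℤ} (h : IsBoundedAbove K) :
    IsBoundedAbove ((pullback π).obj K) := by
  obtain ⟨m, hm⟩ := h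
  refine ⟨m, ?_⟩
  rw [CochainComplex.isStrictlyLE_iff]
  exact fun i hi => (baseChange π).map_isZero (K.isZero_of_isStrictlyLE m i hi)

theorem pullback_isBoundedBelow {K : CochainComplex (ModuleCat.{u} B) ℤ} (h : IsBoundedBelow K) :
    IsBoundedBelow ((pullback π).obj K) := by
  obtain ⟨m, hm⟩ := h
  refine ⟨m, ?_⟩
  rw [CochainComplex.isStrictlyGE_iff]
  exact fun i hi => (baseChange π).map_isZero (K.isZero_of_isStrictlyGE m i hi)

/-- Base change along a section of `π` followed by base change along `π`. -/
def baseChangeSectionIso (σ : A →+* B) (h : π.comp σ = RingHom.id A) :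
    baseChange σ ⋙ baseChange π ≅ 𝟭 (ModuleCat.{u} A) :=
  (ModuleCat.extendScalarsComp.{u} σ π).symm ≪≫ eqToIso (by rw [h]) ≪≫ ModuleCat.extendScalarsId A

end BaseChange

end DerivedPullback

end

/-! ### Independence of the resolution and the three equivalences -/

noncomputable section

namespace DerivedPullback

open Limits HomologicalComplex

theorem projective_mappingCone_X {C : Type*} [Category* C] [Abelian C]
    {P Q : CochainComplex C ℤ} (f : P ⟶ Q) (hP : ∀ i, Projective (P.X i))
    (hQ : ∀ i, Projective (Q.X i)) (i : ℤ) :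
    Projective ((CochainComplex.mappingCone f).X i) :=
  Projective.of_iso (HomologicalComplex.homotopyCofiber.XIsoBiprod f i (i + 1) rfl).symm
    inferInstance

theorem ProjRes.isKProjective {C : Type u} [Category.{v} C] [Abelian C]
    {K : CochainComplex C ℤ} (R : ProjRes K) : R.P.IsKProjective :=
  DerivedPullback.isKProjective R.boundedAbove R.projective

theorem ProjRes.derivedIso {C : Type u} [Category.{v} C] [Abelian C]
    {K : CochainComplex C ℤ} (R : ProjRes K) : DerivedIso R.P K :=
  have := R.quasiIso
  .of_quasiIso R.f

/-- The derived pullback can be computed by any bounded above complex of projective modules that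
is isomorphic to the given complex in the derived category. -/
theorem nonempty_homotopyEquiv_derivedPullback {A B : Type u} [CommRing A] [CommRing B]
    (π : B →+* A) (K : CochainComplex (ModuleCat.{u} B) ℤ) (hK : IsBoundedAbove K)
    {P : CochainComplex (ModuleCat.{u} B) ℤ} (hP : IsBoundedAbove P)
    (hP' : ∀ i, Projective (P.X i)) (h : DerivedIso K P) :
    Nonempty (HomotopyEquiv (derivedPullback π K hK) ((pullback π).obj P)) := by
  have := (projRes K hK).isKProjective
  have := isKProjective hP hP'
  obtain ⟨e⟩ := ((projRes K hK).derivedIso.trans h).nonempty_homotopyEquiv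
  exact ⟨(baseChange π).mapHomotopyEquiv e⟩

theorem isCohomologicallyBounded_iff {C : Type*} [Category* C] [Abelian C]
    {K L : CochainComplex C ℤ} (e : ∀ i, Nonempty (K.homology i ≅ L.homology i)) :
    IsCohomologicallyBounded K ↔ IsCohomologicallyBounded L := by
  have h (i : ℤ) : IsZero (K.homology i) ↔ IsZero (L.homology i) := (e i).some.isZero_iff
  simp only [IsCohomologicallyBounded, h]

theorem isCohomologicallyBounded_of_bounded {C : Type*} [Category* C] [Abelian C]
    {K : CochainComplex C ℤ} (h : IsBoundedAbove K) (h' : IsBoundedBelow K) :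
    IsCohomologicallyBounded K := by
  obtain ⟨m, hm⟩ := h
  obtain ⟨n, hn⟩ := h'
  refine ⟨n, m, fun i hi => (ExactAt.of_isZero ?_).isZero_homology⟩
  rcases hi with hi | hi
  · exact K.isZero_of_isStrictlyGE n i hi
  · exact K.isZero_of_isStrictlyLE m i hi

namespace SplitExtension

variable {A B I : Type u} [CommRing A] [CommRing B] [AddCommGroup I] [Module A I]
  (E : SplitExtension A B I) [Module.Flat A I]

/-- The comparison of a complex with a projective resolution after base change. -/
theorem forall_exactAt_mappingCone_iff {P K : CochainComplex (ModuleCat.{u} B) ℤ} (f : P ⟶ K)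
    [QuasiIso f] (hP : ∀ i, Projective (P.X i)) (hP' : IsBoundedAbove P)
    (hK' : IsBoundedAbove K) (a : ℤ) :
    (∀ j, a ≤ j → (CochainComplex.mappingCone ((pullback E.π).map f)).ExactAt j) ↔
      ∀ j, a ≤ j → (torOne E.π K).ExactAt (j + 2) :=
  -- `torOne` and `leftDerivedOne` differ only in the proof that zero morphisms are preserved, so
  -- they agree definitionally.
  forall_exactAt_mappingCone_map_iff E.shortExactOnProjectives inferInstance E.exact_α_β f hP hP'
    hK' a

theorem isNAdmissible_iff (K : CochainComplex (ModuleCat.{u} B) ℤ) (hK : K.IsStrictlyLE 0)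
    (n : ℕ∞) :
    IsNAdmissible E.π n K ↔
      (∀ i : ℕ, (i : ℕ∞) ≤ n → Function.Bijective (hypertorTo E.π K ⟨0, hK⟩ i)) ∧
      (∀ i : ℕ, (i : ℕ∞) = n + 1 → Function.Surjective (hypertorTo E.π K ⟨0, hK⟩ i)) := by
  have := (projRes K ⟨0, hK⟩).quasiIso
  have key := E.forall_exactAt_mappingCone_iff (projRes K ⟨0, hK⟩).f
    (projRes K ⟨0, hK⟩).projective (projRes K ⟨0, hK⟩).boundedAbove ⟨0, hK⟩
  have hT (j : ℤ) (hj : 0 < j) : (torOne E.π K).ExactAt j :=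
    ExactAt.of_isZero ((tor E.π 1).map_isZero (K.isZero_of_isStrictlyLE 0 j hj))
  -- Since `Tor^1(K)` vanishes in positive cochain degrees, the shift by two makes the cone exact in
  -- degrees `≥ -1` for free.
  have h₀ := (key (-1)).2 fun j hj => hT _ (by lia)
  set φ := derivedPullbackTo E.π K ⟨0, hK⟩ with hφ
  change ∀ a : ℤ, (∀ j, a ≤ j → (CochainComplex.mappingCone φ).ExactAt j) ↔ _ at key
  change ∀ j, -1 ≤ j → (CochainComplex.mappingCone φ).ExactAt j at h₀
  have hsurj (i : ℕ) : Function.Surjective (hypertorTo E.π K ⟨0, hK⟩ i) ↔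
      Epi (homologyMap φ (-(i : ℤ))) := (ModuleCat.epi_iff_surjective _).symm
  have hbij (i : ℕ) : Function.Bijective (hypertorTo E.π K ⟨0, hK⟩ i) ↔
      Mono (homologyMap φ (-(i : ℤ))) ∧ Epi (homologyMap φ (-(i : ℤ))) := by
    rw [ModuleCat.epi_iff_surjective, ModuleCat.mono_iff_injective]
    rfl
  simp only [hsurj, hbij]
  -- Exactness of the cone at `-i` means epi on `H_i` and mono on `H_{i-1}`; the range `i ≤ n + 1`
  -- thus gives bijectivity up to `n` and surjectivity at `n + 1`.
  trans ∀ i : ℕ, (i : ℕ∞) ≤ n + 1 → (CochainComplex.mappingCone φ).ExactAt (-(i : ℤ))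
  · simp only [IsNAdmissible, ← exactAt_iff_isZero_homology]
    constructor
    · intro H i hi
      refine (key (-i)).2 (fun j hj => ?_) _ le_rfl
      obtain hj' | hj' := lt_or_ge 0 (j + 2)
      · exact hT _ hj'
      · obtain ⟨i', hi'⟩ : ∃ i' : ℕ, j + 2 = -(i' : ℤ) := ⟨(j + 2).natAbs, by lia⟩
        rw [hi']
        refine H i' ?_
        have h₁ : i' + 1 + 1 ≤ i := by lia
        have h₂ : ((i' + 1 + 1 : ℕ) : ℕ∞) ≤ n + 1 := le_trans (by exact_mod_cast h₁) hi
        have h₃ : ((i' + 1 : ℕ) : ℕ∞) ≤ n := by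
          induction n with
          | top => exact le_top
          | coe n => norm_cast at h₂ ⊢; lia
        exact lt_of_lt_of_le (by exact_mod_cast Nat.lt_succ_self i') h₃
    · intro H i hi
      have h₁ := (key (-(i + 2 : ℕ))).1 (fun j hj => ?_) _ le_rfl
      · convert h₁ using 1
        push_cast
        ring
      · obtain hj' | hj' := le_or_gt (-1) j
        · exact h₀ j hj'
        · obtain ⟨i', rfl⟩ : ∃ i' : ℕ, j = -(i' : ℤ) := ⟨j.natAbs, by lia⟩
          refine H i' ?_
          have h₁ : i' ≤ i + 1 + 1 := by lia
          refine le_trans (b := ((i + 1 + 1 : ℕ) : ℕ∞)) (by exact_mod_cast h₁) ?_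
          push_cast
          gcongr
          exact Order.add_one_le_of_lt hi
  · constructor
    · intro H
      have hepi (i : ℕ) (hi : (i : ℕ∞) ≤ n + 1) : Epi (homologyMap φ (-(i : ℤ))) :=
        ((exactAt_mappingCone_iff φ _ _ rfl).1 (H i hi)).1
      refine ⟨fun i hi => ⟨?_, hepi i (hi.trans le_self_add)⟩, fun i hi => hepi i hi.le⟩
      refine ((exactAt_mappingCone_iff φ (-((i + 1 : ℕ) : ℤ)) _ (by push_cast; ring)).1
        (H (i + 1) ?_)).2
      push_cast
      gcongr
    · rintro ⟨H₁, H₂⟩ i hi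
      obtain _ | _ | i := i
      · exact h₀ _ (by simp)
      · exact h₀ _ (by simp)
      · have hi' : ((i + 1 : ℕ) : ℕ∞) ≤ n := by
          induction n with
          | top => exact le_top
          | coe n => norm_cast at hi ⊢; lia
        refine (exactAt_mappingCone_iff φ _ (-((i + 1 : ℕ) : ℤ)) (by push_cast; ring)).2
          ⟨?_, (H₁ (i + 1) hi').1⟩
        obtain h | h := hi.lt_or_eq
        · exact (H₁ _ (Order.le_of_lt_add_one h)).2
        · exact H₂ _ h

theorem exists_admissible_iff (K : CochainComplex (ModuleCat.{u} B) ℤ) (m : ℤ)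
    (hK : K.IsStrictlyLE m) :
    (∃ L : CochainComplex (ModuleCat.{u} B) ℤ, L.IsStrictlyLE m ∧ IsBoundedBelow L ∧
      IsAdmissible E.π L ∧ DerivedIso K L) ↔
    IsCohomologicallyBounded (derivedPullback E.π K ⟨m, hK⟩) := by
  constructor
  · rintro ⟨L, hL, hL', hadm, hKL⟩
    let R := projRes L ⟨m, hL⟩
    have := R.quasiIso
    obtain ⟨e⟩ := nonempty_homotopyEquiv_derivedPullback E.π K ⟨m, hK⟩ R.boundedAbove
      R.projective (hKL.trans R.derivedIso.symm)
    have hq : QuasiIso ((pullback E.π).map R.f) := (acyclic_mappingCone_iff _).1 fun i =>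
      (E.forall_exactAt_mappingCone_iff R.f R.projective R.boundedAbove ⟨m, hL⟩ i).2
        (fun j _ => (exactAt_iff_isZero_homology _ _).2 (hadm _)) i le_rfl
    rw [isCohomologicallyBounded_iff (L := (pullback E.π).obj L) fun i =>
      ⟨e.toHomologyIso i ≪≫ isoOfQuasiIsoAt ((pullback E.π).map R.f) i⟩]
    exact isCohomologicallyBounded_of_bounded (pullback_isBoundedAbove E.π ⟨m, hL⟩)
      (pullback_isBoundedBelow E.π hL')
  · intro h
    -- The chosen `projRes` carries no prescribed bound, so a resolution with the same bound `m` is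
    -- used.
    obtain ⟨P, f, hPm, hP, hf⟩ := exists_projective_quasiIso K m
    obtain ⟨e⟩ := nonempty_homotopyEquiv_derivedPullback E.π K ⟨m, hK⟩ ⟨m, hPm⟩ hP
      (DerivedIso.of_quasiIso f).symm
    rw [isCohomologicallyBounded_iff fun i => ⟨e.toHomologyIso i⟩] at h
    obtain ⟨a, _, hab⟩ := h
    have hex (i : ℤ) (hi : i < a) : ((pullback E.π).obj P).ExactAt i :=
      (exactAt_iff_isZero_homology _ _).2 (hab i (Or.inl hi))
    -- `N ≤ a` puts the truncation below the homology of `F P`; `N ≤ m` keeps the truncated complex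
    -- in degrees `≤ m`.
    let N := min a m
    have : P.IsGE N := (CochainComplex.isGE_iff P N).2 fun i hi =>
      E.shortExactOnProjectives.exactAt hP (hex i (by lia))
    refine ⟨P.truncGE N, ?_, ⟨N, inferInstance⟩, fun i => ?_,
      (DerivedIso.of_quasiIso f).symm.trans (.of_quasiIso (P.πTruncGE N))⟩
    · rw [CochainComplex.isStrictlyLE_iff]
      intro i hi
      exact (P.isZero_of_isStrictlyLE m i hi).of_iso (P.truncGEXIso N i (by lia))
    · refine (ExactAt.of_isZero ?_).isZero_homology
      change IsZero ((tor E.π 1).obj ((P.truncGE N).X i))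
      obtain hi | rfl | hi := lt_trichotomy i N
      · exact (tor E.π 1).map_isZero ((P.truncGE N).isZero_of_isStrictlyGE N i hi)
      · have := E.shortExactOnProjectives.mono_app_opcycles inferInstance E.exact_α_β hP
          (hex (N - 1) (by lia))
        exact (isZero_leftDerived_one_of_mono E.shortExactOnProjectives (P.opcycles N)).of_iso
          ((tor E.π 1).mapIso (P.truncGEXIsoOpcycles N))
      · exact (isZero_leftDerived_one_projective (baseChange E.π) (P.X i)).of_iso
          ((tor E.π 1).mapIso (P.truncGEXIso N i hi))

theorem isPerfect_iff (K : CochainComplex (ModuleCat.{u} B) ℤ) (hK : IsBoundedAbove K) :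
    IsPerfect K ↔ IsPerfect (derivedPullback E.π K hK) := by
  constructor
  · rintro ⟨Q, hQ₁, hQ₂, hQ, hKQ⟩
    have hQ' (i : ℤ) : Projective (Q.X i) :=
      have := (hQ i).2
      inferInstance
    obtain ⟨e⟩ := nonempty_homotopyEquiv_derivedPullback E.π K hK hQ₁ hQ' hKQ
    refine ⟨(pullback E.π).obj Q, pullback_isBoundedAbove E.π hQ₁, pullback_isBoundedBelow E.π hQ₂,
      fun i => ⟨?_, ?_⟩, .of_homotopyEquiv e⟩
    · have := (hQ i).1
      exact inferInstanceAs (Module.Finite A ((baseChange E.π).obj (Q.X i)))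
    · have : Projective ((baseChange E.π).obj (Q.X i)) := inferInstance
      exact inferInstanceAs (Module.Projective A ((baseChange E.π).obj (Q.X i)))
  · rintro ⟨Q, hQ₁, hQ₂, hQ, hKQ⟩
    have hQ' (i : ℤ) : Projective (Q.X i) :=
      have := (hQ i).2
      inferInstance
    let R := projRes K hK
    have hRP : ∀ i, Projective (((pullback E.π).obj R.P).X i) := fun i =>
      have := R.projective i
      inferInstanceAs (Projective ((baseChange E.π).obj (R.P.X i)))
    have : (derivedPullback E.π K hK).IsKProjective :=
      isKProjective (pullback_isBoundedAbove E.π R.boundedAbove) hRP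
    have := isKProjective hQ₁ hQ'
    -- Both complexes are bounded above with projective terms. An actual homotopy equivalence is
    -- needed because the perturbation uses its inverse and a homotopy.
    obtain ⟨e⟩ := hKQ.nonempty_homotopyEquiv
    let Q' := (pullback E.σ).obj Q
    let i₁ : (pullback E.π).obj Q' ≅ Q := Hom.isoOfComponents
      (fun i => (baseChangeSectionIso E.π E.σ E.π_σ).app (Q.X i))
      (fun i j _ => ((baseChangeSectionIso E.π E.σ E.π_σ).hom.naturality (Q.d i j)).symm)
    have hQ'proj (i : ℤ) : Projective (Q'.X i) :=
      have := hQ' i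
      inferInstanceAs (Projective ((baseChange E.σ).obj (Q.X i)))
    let e' : HomotopyEquiv (((baseChange E.π).mapHomologicalComplex (ComplexShape.up ℤ)).obj R.P)
        (((baseChange E.π).mapHomologicalComplex (ComplexShape.up ℤ)).obj Q') :=
      e.trans (HomotopyEquiv.ofIso i₁.symm)
    obtain ⟨Q'', hQ'', g, φ, hφ⟩ := exists_lift_of_homotopyEquiv (F := baseChange E.π)
      (P := R.P) (Q := Q')
      (fun _ _ _ _ _ => comp_eq_zero_of_map_eq_zero (w := E.α_comp_β) E.exact_α_β)
      (fun i Y => have := R.projective i; E.baseChange_map_surjective _ Y)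
      (fun i Y => have := hQ'proj i; E.baseChange_map_surjective _ Y) e'
    have hQ''proj (i : ℤ) : Projective (Q''.X i) :=
      Projective.of_iso (hQ'' i).some.symm (hQ'proj i)
    have hg : QuasiIso (((baseChange E.π).mapHomologicalComplex _).map g) := by
      rw [hφ]
      have := e'.quasiIso_inv
      infer_instance
    have hg' : QuasiIso g := by
      rw [← acyclic_mappingCone_iff] at hg ⊢
      intro i
      exact E.shortExactOnProjectives.exactAt
        (projective_mappingCone_X g hQ''proj R.projective) ((hg i).of_iso
          (CochainComplex.mappingCone.mapHomologicalComplexIso g (baseChange E.π)).symm)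
    refine ⟨Q'', ?_, ?_, fun i => ⟨?_, ?_⟩, R.derivedIso.symm.trans (.symm (.of_quasiIso g))⟩
    · obtain ⟨m, hm⟩ := pullback_isBoundedAbove E.σ hQ₁
      refine ⟨m, (CochainComplex.isStrictlyLE_iff _ _).2 fun i hi => ?_⟩
      exact (Q'.isZero_of_isStrictlyLE m i hi).of_iso (hQ'' i).some
    · obtain ⟨m, hm⟩ := pullback_isBoundedBelow E.σ hQ₂
      refine ⟨m, (CochainComplex.isStrictlyGE_iff _ _).2 fun i hi => ?_⟩
      exact (Q'.isZero_of_isStrictlyGE m i hi).of_iso (hQ'' i).some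
    · have := (hQ i).1
      have : Module.Finite B (Q'.X i) :=
        inferInstanceAs (Module.Finite B ((baseChange E.σ).obj (Q.X i)))
      exact Module.Finite.equiv (hQ'' i).some.symm.toLinearEquiv
    · have := hQ''proj i
      infer_instance

end SplitExtension

/-- A trivial extension by a finite free module as a split square-zero extension by a module of
the form `Fin n → A`. -/
theorem exists_splitExtension {k : Type v} {A B : Type u} {I : Type w} [Field k]
    [CommRing A] [Algebra k A] [CommRing B] [Algebra k B] [AddCommGroup I] [Module A I]
    [Module.Free A I] [Module.Finite A I] (E : TrivialExtension k A B I) :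
    ∃ (n : ℕ) (E' : SplitExtension A B (Fin n → A)), E'.π = E.π.toRingHom := by
  obtain ⟨σ, hσ⟩ := E.split
  -- Coordinates replace `I`, which lives in its own universe, by a module in the universe of `A`,
  -- so that tensoring with it is an endofunctor of `ModuleCat.{u} A`.
  let b := Module.Free.chooseBasis A I
  let e : (Fin (Fintype.card (Module.Free.ChooseBasisIndex A I)) → A) ≃ₗ[A] I :=
    (b.reindex (Fintype.equivFin _)).equivFun.symm
  refine ⟨_, { ι := E.ι.comp e.toLinearMap.toAddMonoidHom
               π := E.π.toRingHom
               σ := σ.toRingHom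
               ι_injective := E.ι_injective.comp e.injective
               exact := fun x => ?_
               smul_eq := fun x i => ?_
               π_σ := ?_ }, rfl⟩
  · refine (E.exact x).trans ⟨?_, ?_⟩
    · rintro ⟨i, rfl⟩
      exact ⟨e.symm i, congrArg E.ι (e.apply_symm_apply i)⟩
    · rintro ⟨i, rfl⟩
      exact ⟨e i, rfl⟩
  · exact (congrArg E.ι (map_smul e (E.π x) i)).trans (E.smul_eq x (e i))
  · exact RingHom.ext fun a => DFunLike.congr_fun hσ a

end DerivedPullback

end

open DerivedPullback in
theorem proposition4p16 {k : Type v} {A B : Type u} {I : Type w} [Field k] [CharZero k]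
    [CommRing A] [Algebra k A] [CommRing B] [Algebra k B] [AddCommGroup I] [Module A I]
    [Module.Free A I] [Module.Finite A I] (E : TrivialExtension k A B I) :
    -- `n`-admissibility in terms of hypertor
    (∀ (K : CochainComplex (ModuleCat.{u} B) ℤ) (hK : K.IsStrictlyLE 0) (n : ℕ∞),
      IsNAdmissible E.π.toRingHom n K ↔
        (∀ i : ℕ, (i : ℕ∞) ≤ n →
          Function.Bijective (hypertorTo E.π.toRingHom K ⟨0, hK⟩ i)) ∧
        (∀ i : ℕ, (i : ℕ∞) = n + 1 →
          Function.Surjective (hypertorTo E.π.toRingHom K ⟨0, hK⟩ i))) ∧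
    -- complexes isomorphic in the derived category to a bounded admissible one
    (∀ (K : CochainComplex (ModuleCat.{u} B) ℤ) (m : ℤ) (hK : K.IsStrictlyLE m),
      (∃ L : CochainComplex (ModuleCat.{u} B) ℤ, L.IsStrictlyLE m ∧ IsBoundedBelow L ∧
        IsAdmissible E.π.toRingHom L ∧ DerivedIso K L) ↔
      IsCohomologicallyBounded (derivedPullback E.π.toRingHom K ⟨m, hK⟩)) ∧
    -- perfect complexes
    (∀ (K : CochainComplex (ModuleCat.{u} B) ℤ) (hK : IsBoundedAbove K), IsBoundedBelow K →
      (IsPerfect K ↔ IsPerfect (derivedPullback E.π.toRingHom K hK))) := by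
  obtain ⟨n, E', hE'⟩ := exists_splitExtension E
  rw [← hE']
  exact ⟨E'.isNAdmissible_iff, E'.exists_admissible_iff, fun K hK _ => E'.isPerfect_iff K hK⟩
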